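/- For a finite list $a_\bullet=(a_1,\dots,a_m)$ of nonnegative integers with even sum put $n(a_\bullet):=\frac12(a_1+\cdots+a_m+2)$, and let $K(a_\bullet)$ be the Kostka number of two-rowed rectangular shape: the number of semistandard Young tableaux of shape $(n(a_\bullet)-1,\,n(a_\bullet)-1)$ and content $a_\bullet$, that is, of arrays of two rows of length $n(a_\bullet)-1$ whose entries increase weakly along rows and strictly down columns and in which $i$ occurs exactly $a_i$ times for $i=1,\dots,m$. A Schubert problem (of lines) is a list $a_\bullet$ of positive integers with even sum; it is reduced if $a_i+a_j<n(a_\bullet)$ for all $i<j$. A rearrangement of $a_\bullet$ is a listing of its entries in some order. Let $a_\bullet$ be a reduced Schubert problem involving $m\ge 4$ integers. If $a_\bullet\neq(1,1,1,1)$, then $a_\bullet$ has a rearrangement $(a_1,\dots,a_m)$ such that \[ K(a_1,\dots,a_{m-2},\,a_{m-1}+a_m)\ \neq\ K(a_1,\dots,a_{m-2},\,a_{m-1}-1,\,a_m-1), \] and both terms are nonzero. If $a_\bullet=(1,1,1,1)$, then the two terms are equal, both being $1$; that is, $K(1,1,2)=K(1,1,0,0)=1$. -/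

import Mathlib

namespace SchubertLines

/-- A Schubert problem of lines: a list of positive integers with even sum. -/
def IsSchubertProblem (a : List ℕ) : Prop :=
  (∀ x ∈ a, 0 < x) ∧ Even a.sum

/-- `n(a) = (a₁ + ⋯ + aₘ + 2) / 2`, the dimension of the ambient projective space. -/
def ambientDim (a : List ℕ) : ℕ := (a.sum + 2) / 2

/-- A Schubert problem is reduced if `aᵢ + aⱼ < n(a)` for all positions `i < j`. -/
def IsReduced (a : List ℕ) : Prop :=
  IsSchubertProblem a ∧
    ∀ i j : Fin a.length, i < j → a.get i + a.get j < ambientDim a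

/-- The Young diagram of the rectangular partition `(k, k)`. -/
def twoRows (k : ℕ) : YoungDiagram where
  cells := Finset.range 2 ×ˢ Finset.range k
  isLowerSet := by
    rintro ⟨i, j⟩ ⟨i', j'⟩ h hc
    obtain ⟨h₁, h₂⟩ := Prod.mk_le_mk.mp h
    simp only [Finset.coe_product, Finset.coe_range, Set.mem_prod, Set.mem_Iio] at hc ⊢
    omega

/-- The semistandard Young tableaux of shape `(n(a) - 1, n(a) - 1)` and content
`a = (a₁, …, aₘ)`: the entry `i` occurs exactly `aᵢ` times, for `i = 1, …, m`
(list positions start at `0`, so position `i` of the list belongs to the entry `i + 1`).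
When the sum of `a` is even, the shape has `a₁ + ⋯ + aₘ` cells, so there are no other entries. -/
def tableaux (a : List ℕ) : Set (SemistandardYoungTableau (twoRows (ambientDim a - 1))) :=
  {T | ∀ i : Fin a.length,
    ((twoRows (ambientDim a - 1)).cells.filter fun c => T c.1 c.2 = (i : ℕ) + 1).card = a.get i}

/-- The Kostka number `K(a)`. Zero entries of `a` are allowed. -/
noncomputable def K (a : List ℕ) : ℕ := (tableaux a).ncard

end SchubertLines

/-! `K` of a list is the multiplicity of the trivial module in the tensor product of the
`SL₂`-modules `V_{a_i}` (`K_eq_mult`), and `V_x ⊗ V_y = V_{x+y} ⊕ V_{x-1} ⊗ V_{y-1}`. So the two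
terms add up to `K(a)`, and they agree exactly when the first is half of `K(a)`. Both are nonzero by
the polygon inequalities (`mult_pos`), which reducedness supplies. If the list is not constant, take
entries `y < z` and a third entry `x`. Equality for both pairs `(x, y)` and `(x, z)` would make the
merged terms with `x + y` and `x + z` equal. But `V_z ⊗ V_{x+y}` contains `V_y ⊗ V_{x+z}` together
with further summands, one of which pairs nontrivially with the other factors (`mult_exchange_lt`).
If all entries are `t`, with `n + 2` of them, let `N k` be the multiplicity of `V_k` in the `n`-th
tensor power of `V_t`; the claim is `N (2t) ≠ ∑_{i<t} N (2i)`. For `t = 1` the difference is one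
positive multiplicity. For `t = 2` the `N (2k)` are differences of trinomial coefficients, and
equality would force a ratio of the two central ones that they do not have. For `t ≥ 3`, `N k / (k +
1)` decreases along each parity class (`radialDecreasing_replicate`), and `∑_{i<t} (2i + 1) = t² >
2t + 1` gives a strict inequality. -/

namespace SchubertLines
open Finset

/-! ### Clebsch–Gordan recursion and second-row fillings -/

/-- The multiplicity of the irreducible `SL₂`-module with highest weight `h` in the tensor product
of the modules with highest weights the entries of the list, by the Clebsch–Gordan rule. -/
def mult : ℕ → List ℕ → ℕ
  | h, [] => if h = 0 then 1 else 0
  | h, x :: l => ∑ q ∈ range (min h x + 1), mult (h + x - 2 * q) l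

/-- The lists `q` of second-row multiplicities that can be added to a two-row tableau whose first
row exceeds the second by `h`, so that the final shape is a rectangle. -/
def fillings : ℕ → List ℕ → Finset (List ℕ)
  | h, [] => if h = 0 then {[]} else ∅
  | h, x :: l => (range (min h x + 1)).biUnion fun q =>
      (fillings (h + x - 2 * q) l).image (List.cons q)

lemma card_fillings (l : List ℕ) : ∀ h, (fillings h l).card = mult h l := by
  induction l with
  | nil => intro h; by_cases hh : h = 0 <;> simp [fillings, mult, hh]
  | cons x l ih =>
    intro h
    rw [fillings, mult, card_biUnion]
    · refine sum_congr rfl fun q _ => ?_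
      rw [card_image_of_injective _ List.cons_injective, ih]
    · intro q _ q' _ hq
      rw [Function.onFun, disjoint_left]
      simp only [mem_image, not_exists, not_and]
      rintro _ ⟨s, _, rfl⟩ t _ hts
      exact hq (List.cons.inj hts).1.symm

/-- Unrolls the recursion into partial sums. The second inequality is column strictness: the second
row through step `i + 1` is no longer than the first row through step `i`, whose length is `h` plus
the content so far minus the second row so far. -/
lemma mem_fillings_iff (l : List ℕ) : ∀ (h : ℕ) (s : List ℕ), s ∈ fillings h l ↔
    s.length = l.length ∧
      (∀ i (hi : i < l.length), (s.take (i + 1)).sum - (s.take i).sum ≤ l[i] ∧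
        (s.take (i + 1)).sum + (s.take i).sum ≤ h + (l.take i).sum) ∧
      2 * s.sum = h + l.sum := by
  induction l with
  | nil =>
    intro h s
    by_cases hh : h = 0
    · subst hh; simp only [fillings, if_true, mem_singleton]
      constructor
      · rintro rfl; simp
      · intro hs; simpa using hs.1
    · simp only [fillings, hh, if_false, notMem_empty, false_iff]
      rintro ⟨h1, -, h2⟩
      have : s = [] := by simpa using h1
      subst this
      simp at h2
      omega
  | cons x l ih =>
    intro h s
    simp only [fillings, mem_biUnion, mem_range, mem_image]
    constructor
    · rintro ⟨q, hq, s, hs, rfl⟩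
      obtain ⟨h1, h2, h3⟩ := (ih _ _).1 hs
      refine ⟨by simp [h1], ?_, ?_⟩
      · intro i hi
        cases i with
        | zero => simp; omega
        | succ i =>
          have := h2 i (by simpa using hi)
          simp only [List.take_succ_cons, List.sum_cons, List.getElem_cons_succ] at this ⊢
          omega
      · simp only [List.sum_cons]; omega
    · rintro ⟨h1, h2, h3⟩
      cases s with
      | nil => simp at h1
      | cons q s =>
        have h0 := h2 0 (by simp)
        simp at h0
        refine ⟨q, by omega, s, (ih _ _).2 ⟨by simpa using h1, ?_, ?_⟩, rfl⟩
        · intro i hi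
          have := h2 (i + 1) (by simpa using hi)
          simp only [List.take_succ_cons, List.sum_cons, List.getElem_cons_succ] at this ⊢
          omega
        · simp only [List.sum_cons] at h3; omega

/-! ### Two-row tableaux as row counts -/

lemma mem_twoRows {k r j : ℕ} : (r, j) ∈ twoRows k ↔ r < 2 ∧ j < k := by
  rw [← YoungDiagram.mem_cells]
  simp [twoRows]

/-- The number of entries at most `i` in row `r` of a tableau. -/
def rowCount {k : ℕ} (T : SemistandardYoungTableau (twoRows k)) (r i : ℕ) : ℕ :=
  #{j ∈ range k | T r j ≤ i}

section Tableaux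

variable {k : ℕ} (T : SemistandardYoungTableau (twoRows k))

lemma entry_le_iff {r j : ℕ} (hr : r < 2) (hj : j < k) (i : ℕ) :
    T r j ≤ i ↔ j < rowCount T r i := by
  constructor
  · intro h
    have : range (j + 1) ⊆ {j ∈ range k | T r j ≤ i} := by
      intro j' hj'
      have hj' := mem_range.1 hj'
      refine mem_filter.2 ⟨mem_range.2 (by omega), ?_⟩
      exact (T.row_weak_of_le (by omega) (mem_twoRows.2 ⟨hr, hj⟩)).trans h
    simpa [rowCount] using card_le_card this
  · intro h
    by_contra hlt
    have : ({j ∈ range k | T r j ≤ i} : Finset ℕ) ⊆ range j := by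
      intro j' hj'
      obtain ⟨h1, h2⟩ := mem_filter.1 hj'
      rw [mem_range]
      by_contra hle
      exact hlt ((T.row_weak_of_le (not_lt.1 hle) (mem_twoRows.2 ⟨hr, mem_range.1 h1⟩)).trans h2)
    have := card_le_card this
    rw [card_range] at this
    exact absurd h (by rw [rowCount]; omega)

lemma rowCount_le (r i : ℕ) : rowCount T r i ≤ k :=
  (card_filter_le _ _).trans (card_range k).le

lemma rowCount_mono (r : ℕ) : Monotone (rowCount T r) := fun _ _ h =>
  card_le_card (monotone_filter_right _ fun _ _ hj => le_trans hj h)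

lemma rowCount_succ (r i : ℕ) :
    rowCount T r (i + 1) = rowCount T r i + #{j ∈ range k | T r j = i + 1} := by
  rw [rowCount, rowCount, ← card_union_of_disjoint]
  · congr 1
    ext j
    simp only [mem_filter, mem_union, mem_range]
    omega
  · rw [disjoint_left]
    intro j
    simp only [mem_filter]
    omega

lemma card_cells_filter (f : ℕ → ℕ → ℕ) (k v : ℕ) :
    ((twoRows k).cells.filter fun c => f c.1 c.2 = v).card =
      #{j ∈ range k | f 0 j = v} + #{j ∈ range k | f 1 j = v} := by
  simp only [twoRows, card_filter, sum_product, sum_range_succ, sum_range_zero, zero_add]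

lemma rowCount_one_succ_le (i : ℕ) : rowCount T 1 (i + 1) ≤ rowCount T 0 i := by
  by_contra h
  have hk : rowCount T 0 i < k := (not_le.1 h).trans_le (rowCount_le T 1 (i + 1))
  have h1 := (entry_le_iff T (by norm_num : 1 < 2) hk (i + 1)).2 (not_le.1 h)
  have h2 := T.col_strict (by norm_num : 0 < 1) (mem_twoRows.2 ⟨by norm_num, hk⟩)
  exact lt_irrefl _ ((entry_le_iff T (by norm_num : 0 < 2) hk i).1 (by omega))

/-- The list of multiplicities of `1, …, m` in the second row. -/
def secondRow (m : ℕ) : List ℕ :=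
  (List.range m).map fun i => rowCount T 1 (i + 1) - rowCount T 1 i

lemma sum_take_secondRow {m i : ℕ} (h0 : rowCount T 1 0 = 0) (hi : i ≤ m) :
    ((secondRow T m).take i).sum = rowCount T 1 i := by
  induction i with
  | zero => simp [h0]
  | succ i ih =>
    have hlt : i < (secondRow T m).length := by simpa [secondRow] using hi
    rw [List.sum_take_succ _ _ hlt, ih (by omega)]
    have := rowCount_mono T 1 (Nat.le_add_right i 1)
    simp only [secondRow, List.getElem_map, List.getElem_range]
    omega

lemma sum_take_content {a : List ℕ}
    (hT : ∀ i (hi : i < a.length),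
      ((twoRows k).cells.filter fun c => T c.1 c.2 = i + 1).card = a[i])
    {i : ℕ} (hi : i ≤ a.length) :
    (a.take i).sum + (rowCount T 0 0 + rowCount T 1 0) = rowCount T 0 i + rowCount T 1 i := by
  induction i with
  | zero => simp
  | succ i ih =>
    have h := hT i hi
    rw [card_cells_filter (fun r j => T r j)] at h
    rw [List.sum_take_succ _ _ hi, ← h, rowCount_succ, rowCount_succ]
    have := ih (by omega)
    omega

/-- The prescribed entries already fill all `2 * k` cells, so no entry is `0` or exceeds the length
of `a`. -/
lemma rowCount_of_content {a : List ℕ}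
    (hT : ∀ i (hi : i < a.length),
      ((twoRows k).cells.filter fun c => T c.1 c.2 = i + 1).card = a[i])
    (hk : a.sum = 2 * k) :
    rowCount T 0 0 = 0 ∧ rowCount T 1 0 = 0 ∧ rowCount T 0 a.length = k ∧
      rowCount T 1 a.length = k := by
  have h := sum_take_content T hT le_rfl
  rw [List.take_length] at h
  have h0 := rowCount_le T 0 a.length
  have h1 := rowCount_le T 1 a.length
  omega

/-- The tableau with prescribed numbers `R r i` of entries at most `i` in row `r`. -/
noncomputable def ofRowCount (k : ℕ) (R : ℕ → ℕ → ℕ) (hR : ∀ r i, R r i ≤ k)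
    (m : ℕ) (hm : ∀ r < 2, R r m = k) (h2 : ∀ r i, 2 ≤ r → R r i = 0)
    (h10 : R 1 0 = 0) (hs : ∀ i, R 1 (i + 1) ≤ R 0 i) :
    SemistandardYoungTableau (twoRows k) where
  entry r j := sInf {i | j < R r i}
  row_weak' := by
    intro r j j' hj hc
    obtain ⟨hr, hj'⟩ := mem_twoRows.1 hc
    have hne : {i | j' < R r i}.Nonempty := ⟨m, by simpa [hm r hr] using hj'⟩
    exact Nat.sInf_le (show j < _ from hj.trans (Nat.sInf_mem hne))
  col_strict' := by
    intro r r' j hr hc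
    obtain ⟨hr', hj⟩ := mem_twoRows.1 hc
    obtain rfl : r = 0 := by omega
    obtain rfl : r' = 1 := by omega
    have hne : {i | j < R 1 i}.Nonempty := ⟨m, by simpa [hm 1 hr'] using hj⟩
    have hmem := Nat.sInf_mem hne
    obtain ⟨t, ht⟩ : ∃ t, sInf {i | j < R 1 i} = t + 1 := by
      refine Nat.exists_eq_succ_of_ne_zero fun h => ?_
      rw [h, Set.mem_ofPred_eq, h10] at hmem
      exact absurd hmem (Nat.not_lt_zero _)
    rw [ht] at hmem ⊢
    exact Nat.lt_succ_of_le (Nat.sInf_le (show j < R 0 t from lt_of_lt_of_le hmem (hs t)))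
  zeros' := by
    intro r j hc
    rw [mem_twoRows] at hc
    -- Outside the diagram the infimum is over the empty set, whose value `0` is the one a tableau
    -- must take there.
    have : {i | j < R r i} = ∅ := by
      ext i
      simp only [Set.mem_ofPred_eq, Set.mem_empty_iff_false, iff_false]
      intro h
      by_cases hr : r < 2
      · exact hc ⟨hr, h.trans_le (hR r i)⟩
      · rw [h2 r i (by omega)] at h; omega
    rw [this, Nat.sInf_empty]

lemma rowCount_ofRowCount (k : ℕ) (R : ℕ → ℕ → ℕ) (hR : ∀ r i, R r i ≤ k)
    (m : ℕ) (hm : ∀ r < 2, R r m = k) (h2 : ∀ r i, 2 ≤ r → R r i = 0)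
    (h10 : R 1 0 = 0) (hs : ∀ i, R 1 (i + 1) ≤ R 0 i) (hmono : ∀ r, Monotone (R r))
    {r : ℕ} (hr : r < 2) (i : ℕ) :
    rowCount (ofRowCount k R hR m hm h2 h10 hs) r i = R r i := by
  rw [rowCount]
  have : ({j ∈ range k | ofRowCount k R hR m hm h2 h10 hs r j ≤ i} : Finset ℕ)
      = range (R r i) := by
    ext j
    simp only [mem_filter, mem_range]
    change j < k ∧ sInf {i | j < R r i} ≤ i ↔ _
    constructor
    · rintro ⟨hj, hle⟩
      have hne : {i | j < R r i}.Nonempty := ⟨m, by simpa [hm r hr] using hj⟩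
      have hmem : j < R r (sInf {i | j < R r i}) := Nat.sInf_mem hne
      exact hmem.trans_le (hmono r hle)
    · intro h
      exact ⟨h.trans_le (hR r i), Nat.sInf_le h⟩
  rw [this, card_range]

lemma tableau_ext {T T' : SemistandardYoungTableau (twoRows k)} {m : ℕ}
    (hm : ∀ r < 2, rowCount T r m = k) (hm' : ∀ r < 2, rowCount T' r m = k)
    (h : ∀ r < 2, ∀ i ≤ m, rowCount T r i = rowCount T' r i) : T = T' := by
  ext r j
  by_cases hc : (r, j) ∈ twoRows k
  · obtain ⟨hr, hj⟩ := mem_twoRows.1 hc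
    have key : ∀ i ≤ m, T r j ≤ i ↔ T' r j ≤ i := fun i hi => by
      rw [entry_le_iff T hr hj, entry_le_iff T' hr hj, h r hr i hi]
    have h1 : T r j ≤ m := (entry_le_iff T hr hj m).2 (by rw [hm r hr]; exact hj)
    have h2 : T' r j ≤ m := (entry_le_iff T' hr hj m).2 (by rw [hm' r hr]; exact hj)
    exact le_antisymm ((key _ h2).2 le_rfl) ((key _ h1).1 le_rfl)
  · rw [T.zeros hc, T'.zeros hc]

lemma sum_take_mono (s : List ℕ) : Monotone fun i => (s.take i).sum :=
  monotone_nat_of_le_succ fun i => by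
    by_cases hi : i < s.length
    · rw [List.sum_take_succ _ _ hi]; omega
    · rw [List.take_of_length_le (by omega), List.take_of_length_le (by omega)]

lemma sum_take_eq_sum {s : List ℕ} {i : ℕ} (hi : s.length ≤ i) : (s.take i).sum = s.sum := by
  rw [List.take_of_length_le hi]

lemma secondRow_mem_fillings {a : List ℕ} (hk : a.sum = 2 * k)
    (hT : ∀ i (hi : i < a.length),
      ((twoRows k).cells.filter fun c => T c.1 c.2 = i + 1).card = a[i]) :
    secondRow T a.length ∈ fillings 0 a := by
  obtain ⟨h00, h10, h0m, h1m⟩ := rowCount_of_content T hT hk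
  have hlen : (secondRow T a.length).length = a.length := by simp [secondRow]
  refine (mem_fillings_iff _ _ _).2 ⟨hlen, ?_, ?_⟩
  · intro i hi
    rw [sum_take_secondRow T h10 (show i + 1 ≤ a.length from hi), sum_take_secondRow T h10 hi.le]
    have e1 := sum_take_content T hT hi.le
    have e2 := sum_take_content T hT (i := i + 1) hi
    rw [List.sum_take_succ _ _ hi] at e2
    have := rowCount_one_succ_le T i
    have := rowCount_mono T 0 (Nat.le_add_right i 1)
    omega
  · have := sum_take_secondRow T h10 (le_refl a.length)
    rw [sum_take_eq_sum hlen.le] at this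
    omega

lemma exists_tableau_of_mem_fillings {a s : List ℕ} (hk : a.sum = 2 * k) (hs : s ∈ fillings 0 a) :
    ∃ T : SemistandardYoungTableau (twoRows k), (∀ i (hi : i < a.length),
      ((twoRows k).cells.filter fun c => T c.1 c.2 = i + 1).card = a[i]) ∧
      secondRow T a.length = s := by
  obtain ⟨hlen, hstep, hsum⟩ := (mem_fillings_iff _ _ _).1 hs
  have hQ := sum_take_mono s
  have hA := sum_take_mono a
  have hQle : ∀ i, (s.take i).sum ≤ (a.take i).sum ∧
      (a.take i).sum - (s.take i).sum ≤ (a.take (i + 1)).sum - (s.take (i + 1)).sum ∧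
      (s.take (i + 1)).sum ≤ (a.take i).sum - (s.take i).sum := by
    intro i
    have hq := hQ (Nat.le_add_right i 1)
    have ha := hA (Nat.le_add_right i 1)
    simp only at hq ha
    by_cases hi : i < a.length
    · obtain ⟨h1, h2⟩ := hstep i hi
      rw [List.sum_take_succ _ _ hi]
      omega
    · rw [sum_take_eq_sum (s := s) (by omega), sum_take_eq_sum (s := s) (by omega),
        sum_take_eq_sum (s := a) (by omega), sum_take_eq_sum (s := a) (by omega)]
      omega
  let R : ℕ → ℕ → ℕ := fun r i =>
    if r = 0 then (a.take i).sum - (s.take i).sum else if r = 1 then (s.take i).sum else 0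
  have hmono : ∀ r, Monotone (R r) := by
    intro r
    refine monotone_nat_of_le_succ fun i => ?_
    have hq := hQ (Nat.le_add_right i 1)
    simp only [R]
    split_ifs
    · exact (hQle i).2.1
    · exact hq
    · exact le_rfl
  have hm : ∀ r < 2, R r a.length = k := by
    intro r hr
    simp only [R, sum_take_eq_sum (s := a) le_rfl, sum_take_eq_sum (s := s) hlen.le]
    split_ifs <;> omega
  have h2 : ∀ r i, 2 ≤ r → R r i = 0 := by
    intro r i hr
    simp only [R]
    rw [if_neg (by omega), if_neg (by omega)]
  have hR : ∀ r i, R r i ≤ k := by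
    intro r i
    by_cases hr : r < 2
    · rw [← hm r hr]
      by_cases hi : i ≤ a.length
      · exact hmono r hi
      · simp only [R]
        rw [sum_take_eq_sum (s := s) (by omega), sum_take_eq_sum (s := a) (by omega),
          sum_take_eq_sum (s := s) (by omega), sum_take_eq_sum (s := a) (by omega)]
    · rw [h2 r i (by omega)]; omega
  have h10 : R 1 0 = 0 := by simp [R]
  have hst : ∀ i, R 1 (i + 1) ≤ R 0 i := by
    intro i; simpa [R] using (hQle i).2.2
  have hc := fun {r : ℕ} (hr : r < 2) i =>
    rowCount_ofRowCount k R hR a.length hm h2 h10 hst hmono hr i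
  refine ⟨ofRowCount k R hR a.length hm h2 h10 hst, ?_, ?_⟩
  · intro i hi
    have e0 := rowCount_succ (ofRowCount k R hR a.length hm h2 h10 hst) 0 i
    have e1 := rowCount_succ (ofRowCount k R hR a.length hm h2 h10 hst) 1 i
    rw [hc (by norm_num), hc (by norm_num)] at e0 e1
    rw [card_cells_filter (fun r j => ofRowCount k R hR a.length hm h2 h10 hst r j)]
    have e2 := List.sum_take_succ a i hi
    obtain ⟨f1, f2, f3⟩ := hQle i
    have f4 := (hQle (i + 1)).1
    have r0 : ∀ i, R 0 i = (a.take i).sum - (s.take i).sum := fun i => by simp [R]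
    have r1 : ∀ i, R 1 i = (s.take i).sum := fun i => by simp [R]
    rw [r0, r0] at e0
    rw [r1, r1] at e1
    omega
  · refine List.ext_getElem (by simp [secondRow, hlen]) fun i h1 h2 => ?_
    simp only [secondRow, List.getElem_map, List.getElem_range]
    rw [hc (by norm_num), hc (by norm_num)]
    simp only [R, if_true, one_ne_zero, if_false]
    rw [List.sum_take_succ _ _ h2]
    omega

/-- The Kostka number of rectangular two-row shape is an `SL₂` multiplicity. -/
theorem K_eq_mult {a : List ℕ} (ha : Even a.sum) : K a = mult 0 a := by
  have hk : a.sum = 2 * (ambientDim a - 1) := by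
    obtain ⟨t, ht⟩ := ha
    rw [ambientDim]; omega
  rw [K, ← card_fillings, ← Set.ncard_coe_finset]
  refine Set.ncard_congr (fun T _ => secondRow T a.length) ?_ ?_ ?_
  · intro T hT
    exact secondRow_mem_fillings T hk fun i hi => hT ⟨i, hi⟩
  · intro T T' hT hT' h
    have c := fun i hi => hT ⟨i, hi⟩
    have c' := fun i hi => hT' ⟨i, hi⟩
    obtain ⟨h00, h10, h0m, h1m⟩ := rowCount_of_content T c hk
    obtain ⟨h00', h10', h0m', h1m'⟩ := rowCount_of_content T' c' hk
    have e1 : ∀ i ≤ a.length, rowCount T 1 i = rowCount T' 1 i := fun i hi => by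
      rw [← sum_take_secondRow T h10 hi, ← sum_take_secondRow T' h10' hi, h]
    refine tableau_ext (m := a.length) ?_ ?_ ?_
    · intro r hr; interval_cases r <;> assumption
    · intro r hr; interval_cases r <;> assumption
    · intro r hr i hi
      interval_cases r
      · have := sum_take_content T c hi
        have := sum_take_content T' c' hi
        have := e1 i hi
        omega
      · exact e1 i hi
  · intro s hs
    obtain ⟨T, hT, hT'⟩ := exists_tableau_of_mem_fillings hk hs
    exact ⟨T, fun i => hT i i.2, hT'⟩

end Tableaux

/-! ### Positivity from the polygon inequalities -/

lemma mult_pos (l : List ℕ) : ∀ h, Even (h + l.sum) → h ≤ l.sum → (∀ x ∈ l, 2 * x ≤ h + l.sum) →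
    0 < mult h l := by
  induction l with
  | nil =>
    intro h _ h1 _
    have : h = 0 := by simpa using h1
    simp [mult, this]
  | cons x l ih =>
    intro h he hle hall
    have hx := hall x (by simp)
    rw [List.sum_cons] at he hle hx hall
    obtain ⟨t, ht⟩ := he
    -- Pass to the largest summand of `V_h ⊗ V_x` not exceeding the sum of the remaining weights;
    -- the polygon inequalities persist for it.
    have hq : ∃ q, q ≤ h ∧ q ≤ x ∧ h + x - 2 * q = min (h + x) l.sum := by
      refine ⟨(h + x - min (h + x) l.sum) / 2, ?_, ?_, ?_⟩ <;> omega
    obtain ⟨q, hqh, hqx, hq⟩ := hq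
    rw [mult]
    refine lt_of_lt_of_le ?_ (single_le_sum (f := fun q => mult (h + x - 2 * q) l)
      (fun _ _ => Nat.zero_le _) (mem_range.2 (by omega : q < min h x + 1)))
    rw [hq]
    refine ih _ ?_ (min_le_right _ _) ?_
    · rw [← hq]; exact ⟨t - q, by omega⟩
    · intro y hy
      have h1 := hall y (by simp [hy])
      have h2 := List.le_sum_of_mem hy
      omega

/-! ### Formal characters and symmetry in the factors -/

/-- The product of a function on the weights with the character of the module of highest
weight `x`. -/
def charMul (x : ℕ) (F : ℤ → ℤ) : ℤ → ℤ := fun h => ∑ q ∈ range (x + 1), F (h + x - 2 * q)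

lemma charMul_comm (x y : ℕ) (F : ℤ → ℤ) :
    charMul x (charMul y F) = charMul y (charMul x F) := by
  funext h
  simp only [charMul]
  rw [sum_comm]
  refine sum_congr rfl fun q _ => sum_congr rfl fun r _ => ?_
  congr 1; ring

/-- Clebsch–Gordan: `V_{x+1} ⊗ V_{y+1} = V_{x+y+2} ⊕ V_x ⊗ V_y`. -/
lemma charMul_succ_succ (x y : ℕ) (F : ℤ → ℤ) (h : ℤ) :
    charMul (x + 1) (charMul (y + 1) F) h =
      charMul (x + y + 2) F h + charMul x (charMul y F) h := by
  simp only [charMul]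
  have e : ∀ q : ℕ, ∑ r ∈ range (y + 1 + 1), F (h + ↑(x + 1) - 2 * q + ↑(y + 1) - 2 * r) =
      F (h + ↑(x + y + 2) - 2 * q) + ∑ r ∈ range (y + 1), F (h + x - 2 * q + y - 2 * r) := by
    intro q
    rw [sum_range_succ', add_comm]
    congr 1
    · congr 1; push_cast; ring
    · refine sum_congr rfl fun r _ => ?_
      congr 1; push_cast; ring
  simp only [e, sum_add_distrib]
  rw [sum_range_succ (fun q : ℕ => ∑ r ∈ range (y + 1), F (h + x - 2 * q + y - 2 * r)),
    show x + y + 2 + 1 = (x + 1 + 1) + (y + 1) by ring, sum_range_add _ (x + 1 + 1) (y + 1)]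
  have e2 : ∑ r ∈ range (y + 1), F (h + x - 2 * ↑(x + 1) + y - 2 * r) =
      ∑ r ∈ range (y + 1), F (h + ↑(x + y + 2) - 2 * ↑(x + 1 + 1 + r)) := by
    refine sum_congr rfl fun r _ => ?_
    congr 1; push_cast; ring
  rw [e2]
  ring

/-- Antisymmetry under the reflection `h ↦ -2 - h` of the dotted Weyl group action. -/
def Alternating (F : ℤ → ℤ) : Prop := ∀ h, F (-2 - h) = -F h

lemma Alternating.charMul {F : ℤ → ℤ} (hF : Alternating F) (x : ℕ) :
    Alternating (charMul x F) := by
  intro h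
  simp only [SchubertLines.charMul]
  rw [← sum_range_reflect, ← sum_neg_distrib]
  refine sum_congr rfl fun q hq => ?_
  rw [← hF]
  congr 1
  have hq := mem_range.1 hq
  have : ((x + 1 - 1 - q : ℕ) : ℤ) = x - q := by omega
  rw [this]; ring

lemma Alternating.sum_eq_zero {F : ℤ → ℤ} (hF : Alternating F) (n : ℕ) :
    ∑ i ∈ range n, F (n - 2 - 2 * i) = 0 := by
  have h : ∑ i ∈ range n, F (n - 2 - 2 * i) = -∑ i ∈ range n, F (n - 2 - 2 * i) := by
    conv_lhs => rw [← sum_range_reflect]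
    rw [← sum_neg_distrib]
    refine sum_congr rfl fun i hi => ?_
    rw [← hF]
    congr 1
    have hi := mem_range.1 hi
    have : ((n - 1 - i : ℕ) : ℤ) = n - 1 - i := by omega
    rw [this]; ring
  linarith

/-- For `h < x` the terms beyond `q = h` sit symmetrically about `-1` and cancel. This turns the
full character product into the truncated Clebsch–Gordan sum. -/
lemma Alternating.charMul_apply {F : ℤ → ℤ} (hF : Alternating F) (x h : ℕ) :
    SchubertLines.charMul x F h = ∑ q ∈ range (min h x + 1), F (h + x - 2 * q) := by
  rw [SchubertLines.charMul]
  rcases le_total x h with hx | hx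
  · rw [min_eq_right hx]
  · rw [min_eq_left hx]
    obtain ⟨n, rfl⟩ := Nat.exists_eq_add_of_le hx
    rw [show h + n + 1 = (h + 1) + n by ring, sum_range_add]
    have := hF.sum_eq_zero n
    rw [add_eq_left, ← this]
    refine sum_congr rfl fun i _ => ?_
    congr 1; push_cast; ring

/-- The product of a function on the weights with the characters of the modules in a list. -/
def charProd (l : List ℕ) (F : ℤ → ℤ) : ℤ → ℤ := l.foldr charMul F

lemma charProd_cons (x : ℕ) (l : List ℕ) (F : ℤ → ℤ) :
    charProd (x :: l) F = charMul x (charProd l F) := rfl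

lemma charProd_perm {l l' : List ℕ} (h : l.Perm l') (F : ℤ → ℤ) :
    charProd l F = charProd l' F :=
  haveI : LeftCommutative charMul := ⟨charMul_comm⟩
  h.foldr_eq _

/-- The Weyl denominator. -/
def denom : ℤ → ℤ := fun h => (if h = 0 then 1 else 0) - (if h = -2 then 1 else 0)

lemma alternating_denom : Alternating denom := by
  intro h
  have h1 : (-2 - h = 0) ↔ (h = -2) := by omega
  have h2 : (-2 - h = -2) ↔ (h = 0) := by omega
  simp only [denom, h1, h2]
  ring

lemma alternating_charProd (l : List ℕ) : Alternating (charProd l denom) := by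
  induction l with
  | nil => exact alternating_denom
  | cons x l ih => exact ih.charMul x

lemma mult_eq_charProd (l : List ℕ) : ∀ h : ℕ, (mult h l : ℤ) = charProd l denom h := by
  induction l with
  | nil =>
    intro h
    have : (h : ℤ) ≠ -2 := by omega
    simp [mult, charProd, denom, this]
  | cons x l ih =>
    intro h
    rw [charProd_cons, (alternating_charProd l).charMul_apply, mult, Nat.cast_sum]
    refine sum_congr rfl fun q hq => ?_
    rw [ih]
    congr 1
    have := mem_range.1 hq
    omega

/-- The recursion for `mult` is not visibly symmetric, but multiplication by characters commutes. -/
lemma mult_perm {l l' : List ℕ} (h : l.Perm l') (k : ℕ) : mult k l = mult k l' := by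
  have := charProd_perm h denom
  exact_mod_cast (by rw [mult_eq_charProd, mult_eq_charProd, this] : (mult k l : ℤ) = mult k l')

lemma mult_zero_cons (x : ℕ) (l : List ℕ) : mult 0 (x :: l) = mult x l := by
  simp [mult]

lemma mult_append_singleton (b : List ℕ) (x : ℕ) : mult 0 (b ++ [x]) = mult x b := by
  rw [mult_perm (List.perm_append_singleton x b), mult_zero_cons]

lemma mult_append_pair (b : List ℕ) (x y : ℕ) :
    mult 0 (b ++ [x, y]) = ∑ q ∈ range (min x y + 1), mult (x + y - 2 * q) b := by
  rw [mult_perm (List.perm_append_comm : (b ++ [x, y]).Perm ([x, y] ++ b))]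
  simp only [List.cons_append, List.nil_append, mult_zero_cons]
  rw [mult]

lemma mult_clebschGordan (b : List ℕ) {x y : ℕ} (hx : 0 < x) (hy : 0 < y) :
    mult 0 (b ++ [x, y]) = mult 0 (b ++ [x + y]) + mult 0 (b ++ [x - 1, y - 1]) := by
  rw [mult_append_pair, mult_append_pair, mult_append_singleton, sum_range_succ', add_comm,
    show min x y = min (x - 1) (y - 1) + 1 by omega]
  congr 1
  refine sum_congr rfl fun q _ => ?_
  congr 1
  omega

/-! ### Reduced problems and non-constant lists -/

lemma IsReduced.exists_of_perm {a l : List ℕ} (ha : IsReduced a) (hl : l.Perm a) :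
    ∃ s, l.sum = 2 * s ∧ (∀ x ∈ l, 0 < x) ∧ l.Pairwise fun x y => x + y ≤ s := by
  obtain ⟨⟨hpos, t, ht⟩, hred⟩ := ha
  refine ⟨t, ?_, fun x hx => hpos x (hl.mem_iff.1 hx), ?_⟩
  · rw [hl.sum_eq, ht]; ring
  · refine (hl.pairwise_iff fun {x y} h => by omega).2 ?_
    rw [List.pairwise_iff_get]
    intro i j hij
    have := hred i j hij
    rw [ambientDim] at this
    omega

lemma mult_pos_of_reduced {b : List ℕ} {x y s : ℕ} (hb : b ≠ []) (hsum : (b ++ [x, y]).sum = 2 * s)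
    (hpos : ∀ z ∈ b ++ [x, y], 0 < z) (hpair : (b ++ [x, y]).Pairwise fun x y => x + y ≤ s) :
    0 < mult 0 (b ++ [x + y]) ∧ 0 < mult 0 (b ++ [x - 1, y - 1]) := by
  have hx := hpos x (by simp)
  have hy := hpos y (by simp)
  rw [List.pairwise_append] at hpair
  obtain ⟨-, hxy, hbx⟩ := hpair
  have hxy : x + y ≤ s := by simpa using hxy
  simp only [List.sum_append, List.sum_cons, List.sum_nil] at hsum
  obtain ⟨w, hw⟩ := List.exists_mem_of_ne_nil b hb
  have hwx := hbx w hw x (by simp)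
  have hwpos := hpos w (by simp [hw])
  constructor
  · refine mult_pos _ _ ⟨s, ?_⟩ (Nat.zero_le _) ?_
    · simp only [List.sum_append, List.sum_cons, List.sum_nil]; omega
    · intro z hz
      simp only [List.sum_append, List.sum_cons, List.sum_nil]
      rcases List.mem_append.1 hz with hz | hz
      · have := hbx z hz x (by simp)
        omega
      · have : z = x + y := by simpa using hz
        omega
  · refine mult_pos _ _ ⟨s - 1, ?_⟩ (Nat.zero_le _) ?_
    · simp only [List.sum_append, List.sum_cons, List.sum_nil]; omega
    · intro z hz
      simp only [List.sum_append, List.sum_cons, List.sum_nil]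
      rcases List.mem_append.1 hz with hz | hz
      · have := hbx z hz x (by simp)
        omega
      · have : z = x - 1 ∨ z = y - 1 := by simpa using hz
        omega

/-- Both tensor products of the last two factors start at weight `x + y + z` and descend by 2, but
the left one stops after `q = y` while the right one continues to `q = min z (x + y) > y`. -/
lemma mult_exchange_lt {c : List ℕ} {x y z s : ℕ} (hyz : y < z)
    (hsum : (c ++ [x, y, z]).sum = 2 * s) (hpos : ∀ w ∈ c ++ [x, y, z], 0 < w)
    (hpair : (c ++ [x, y, z]).Pairwise fun x y => x + y ≤ s) :
    mult 0 (c ++ [y, x + z]) < mult 0 (c ++ [z, x + y]) := by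
  have hx := hpos x (by simp)
  rw [List.pairwise_append] at hpair
  obtain ⟨-, hxyz, hc⟩ := hpair
  have hxyz : (x + y ≤ s ∧ x + z ≤ s) ∧ y + z ≤ s := by simpa using hxyz
  simp only [List.sum_append, List.sum_cons, List.sum_nil] at hsum
  rw [mult_append_pair, mult_append_pair]
  have e : ∀ q, y + (x + z) - 2 * q = z + (x + y) - 2 * q := fun q => by omega
  simp only [e]
  -- The first new summand is `q = y + 1`, of weight `x + z - y - 2`; a larger `q` is taken if that
  -- weight exceeds `c.sum`.
  have hq : ∃ q, y < q ∧ q ≤ z ∧ q ≤ x + y ∧ z + (x + y) - 2 * q = min (x + z - y - 2) c.sum := by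
    refine ⟨(z + (x + y) - min (x + z - y - 2) c.sum) / 2, ?_, ?_, ?_, ?_⟩ <;> omega
  obtain ⟨q, h1, h2, h3, h4⟩ := hq
  refine sum_lt_sum_of_subset (i := q) (range_mono (by omega)) (mem_range.2 (by omega))
    (fun h => ?_) ?_ (fun _ _ _ => Nat.zero_le _)
  · have := mem_range.1 h
    omega
  · rw [h4]
    refine mult_pos _ _ ⟨s - q, by omega⟩ (min_le_right _ _) ?_
    intro w hw
    have := hc w hw z (by simp)
    have := List.le_sum_of_mem hw
    omega

lemma exists_pair_of_exchange {c : List ℕ} {x y z s : ℕ} (hyz : y < z)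
    (hsum : (c ++ [x, y, z]).sum = 2 * s) (hpos : ∀ w ∈ c ++ [x, y, z], 0 < w)
    (hpair : (c ++ [x, y, z]).Pairwise fun x y => x + y ≤ s) :
    ∃ b x' y', (b ++ [x', y']).Perm (c ++ [x, y, z]) ∧
      mult 0 (b ++ [x' + y']) ≠ mult 0 (b ++ [x' - 1, y' - 1]) := by
  have hlt := mult_exchange_lt hyz hsum hpos hpair
  have hx := hpos x (by simp)
  have hy := hpos y (by simp)
  have hz := hpos z (by simp)
  have p1 : ((c ++ [z]) ++ [x, y]).Perm (c ++ [x, y, z]) := by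
    rw [List.append_assoc]
    exact List.Perm.append_left c (List.perm_append_comm (l₁ := [z]) (l₂ := [x, y]))
  have p2 : ((c ++ [y]) ++ [x, z]).Perm (c ++ [x, y, z]) := by
    rw [List.append_assoc]
    exact List.Perm.append_left c (List.Perm.swap x y [z])
  -- If both pairs gave equality, each merged term would be half of the same multiplicity, against
  -- `hlt`.
  by_contra hcon
  push Not at hcon
  have e1 := hcon _ _ _ p1
  have e2 := hcon _ _ _ p2
  have c1 := mult_clebschGordan (c ++ [z]) hx hy
  have c2 := mult_clebschGordan (c ++ [y]) hx hz
  rw [mult_perm p1] at c1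
  rw [mult_perm p2] at c2
  simp only [List.append_assoc, List.cons_append, List.nil_append] at e1 e2 c1 c2
  omega

lemma exists_perm_of_not_const {a : List ℕ} (h4 : 4 ≤ a.length)
    (hne : ¬ ∃ t, ∀ x ∈ a, x = t) :
    ∃ c x y z, y < z ∧ (c ++ [x, y, z]).Perm a := by
  have : ∃ y z, y < z ∧ y ∈ a ∧ z ∈ a := by
    by_contra hcon
    push Not at hcon
    refine hne ⟨a.head (by rintro rfl; simp at h4), fun x hx => ?_⟩
    have hh := List.head_mem (l := a) (by rintro rfl; simp at h4)
    rcases lt_trichotomy x (a.head (by rintro rfl; simp at h4)) with h | h | h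
    · exact absurd hh (hcon _ _ h hx)
    · exact h
    · exact absurd hx (hcon _ _ h hh)
  obtain ⟨y, z, hyz, hy, hz⟩ := this
  have q1 := List.perm_cons_erase hy
  have hz' : z ∈ a.erase y := (List.mem_erase_of_ne hyz.ne').2 hz
  have q2 := List.perm_cons_erase hz'
  have hl := (q1.trans (q2.cons y)).length_eq
  obtain ⟨x, c, hc⟩ : ∃ x c, (a.erase y).erase z = x :: c := by
    cases h : (a.erase y).erase z with
    | nil => rw [h] at hl; simp at hl; omega
    | cons x c => exact ⟨x, c, rfl⟩
  refine ⟨c, x, y, z, hyz, ?_⟩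
  have := q1.trans (q2.cons y)
  rw [hc] at this
  refine (List.perm_append_comm.trans ?_).trans this.symm
  exact (List.Perm.swap y x (z :: c)).trans ((List.Perm.swap z x c).cons y)

/-! ### Constant lists with entry 1 -/

lemma mult_replicate_one_ne {n : ℕ} (hn : 3 ≤ n) (he : Even n) :
    mult 2 (List.replicate n 1) ≠ mult 0 (List.replicate n 1) := by
  obtain ⟨n, rfl⟩ : ∃ k, n = k + 1 := ⟨n - 1, by omega⟩
  obtain ⟨r, hr⟩ := he
  -- Splitting off one factor `V_1`, the two sides differ exactly by this multiplicity of `V_3`.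
  have h3 : 0 < mult 3 (List.replicate n 1) := by
    refine mult_pos _ _ ⟨r + 1, ?_⟩ ?_ ?_
    · simp; omega
    · simp; omega
    · intro x hx
      have := List.eq_of_mem_replicate hx
      simp; omega
  rw [List.replicate_succ, mult, mult]
  simp [sum_range_succ]
  omega

/-! ### Constant lists with entry 2: trinomial coefficients -/

/-- The trinomial coefficients: the coefficient of `u ^ k` in `(u⁻¹ + 1 + u) ^ n`. -/
def trinomial : ℕ → ℤ → ℤ
  | 0, k => if k = 0 then 1 else 0
  | n + 1, k => trinomial n (k - 1) + trinomial n k + trinomial n (k + 1)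

lemma trinomial_neg (n : ℕ) : ∀ k, trinomial n (-k) = trinomial n k := by
  induction n with
  | zero => intro k; simp [trinomial]
  | succ n ih =>
    intro k
    rw [trinomial, trinomial, ← ih (k - 1), ← ih (k + 1), ih k]
    ring_nf

/-- With `P = u⁻¹ + 1 + u`, this compares coefficients in `P · u(Pⁿ)' = n (u - u⁻¹) Pⁿ`. In the
induction, the relations at `k - 1`, `k`, `k + 1` simply add up. -/
lemma trinomial_contiguous (n : ℕ) : ∀ k : ℤ,
    (n + k + 1) * trinomial n (k + 1) = (n - k + 1) * trinomial n (k - 1) - k * trinomial n k := by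
  induction n with
  | zero =>
    intro k
    simp only [trinomial]
    rcases eq_or_ne k 0 with rfl | h0
    · simp
    · rcases eq_or_ne k 1 with rfl | h1
      · simp
      · rcases eq_or_ne (k + 1) 0 with h2 | h2
        · obtain rfl : k = -1 := by omega
          simp
        · rw [if_neg h2, if_neg h0, if_neg (by omega)]; ring
  | succ n ih =>
    intro k
    have e1 := ih (k + 1)
    have e2 := ih (k - 1)
    have e3 := ih k
    simp only [trinomial]
    rw [show k + 1 - 1 = k by ring] at e1 ⊢
    rw [show k - 1 + 1 = k by ring] at e2 ⊢
    push_cast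
    linear_combination e1 + e2 + e3

/-- `V_2` has character `P` with `u` of weight 2, and the Weyl denominator takes the difference of
neighbouring weight multiplicities. -/
lemma charProd_replicate_two (n : ℕ) : ∀ k : ℤ,
    charProd (List.replicate n 2) denom (2 * k) = trinomial n k - trinomial n (k + 1) := by
  induction n with
  | zero =>
    intro k
    have h1 : (2 * k = -2) ↔ (k + 1 = 0) := by omega
    simp [charProd, denom, trinomial, h1]
  | succ n ih =>
    intro k
    rw [List.replicate_succ, charProd_cons, charMul, trinomial, trinomial]
    simp only [sum_range_succ, sum_range_zero]
    rw [show 2 * k + (2 : ℕ) - 2 * (0 : ℕ) = 2 * (k + 1) by push_cast; ring,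
      show 2 * k + (2 : ℕ) - 2 * (1 : ℕ) = 2 * k by push_cast; ring,
      show 2 * k + (2 : ℕ) - 2 * (2 : ℕ) = 2 * (k - 1) by push_cast; ring, ih, ih, ih,
      show k - 1 + 1 = k by ring, show k + 1 - 1 = k by ring]
    ring

lemma trinomial_succ_zero (n : ℕ) :
    trinomial (n + 1) 0 = trinomial n 0 + 2 * trinomial n 1 := by
  have h := trinomial_neg n 1
  rw [trinomial, show (0 : ℤ) - 1 = -1 by ring, show (0 : ℤ) + 1 = 1 by ring, h]
  ring

lemma trinomial_two (n : ℕ) :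
    ((n : ℤ) + 2) * trinomial n 2 = n * trinomial n 0 - trinomial n 1 := by
  have h := trinomial_contiguous n 1
  norm_num at h
  linear_combination h

lemma trinomial_three (n : ℕ) :
    ((n : ℤ) + 3) * trinomial n 3 = (n - 1) * trinomial n 1 - 2 * trinomial n 2 := by
  have h := trinomial_contiguous n 2
  norm_num at h
  linear_combination h

lemma trinomial_succ_one (n : ℕ) :
    ((n : ℤ) + 2) * trinomial (n + 1) 1 =
      (2 * n + 2) * trinomial n 0 + (n + 1) * trinomial n 1 := by
  have h := trinomial_two n
  rw [trinomial, show (1 : ℤ) - 1 = 0 by ring, show (1 : ℤ) + 1 = 2 by ring]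
  linear_combination h

lemma trinomial_bounds (n : ℕ) : 0 < trinomial n 0 ∧ 0 ≤ trinomial n 1 ∧
    trinomial n 1 ≤ trinomial n 0 ∧ n * trinomial n 0 ≤ (n + 1) * trinomial n 1 := by
  induction n with
  | zero => simp [trinomial]
  | succ n ih =>
    obtain ⟨h1, h2, h3, h4⟩ := ih
    have e0 := trinomial_succ_zero n
    have e1 := trinomial_succ_one n
    have hn : (0 : ℤ) < (n : ℤ) + 2 := by positivity
    refine ⟨by omega, ?_, ?_, ?_⟩
    · refine nonneg_of_mul_nonneg_right ?_ hn
      rw [e1]; positivity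
    · refine le_of_mul_le_mul_left ?_ hn
      rw [e1, e0]
      nlinarith
    · push_cast
      rw [show (n : ℤ) + 1 + 1 = n + 2 by ring, e1, e0]
      nlinarith

/-- The central two trinomial coefficients, by their recursion. -/
def trinomialPair : ℕ → ℤ × ℤ
  | 0 => (1, 0)
  | n + 1 => ((trinomialPair n).1 + 2 * (trinomialPair n).2,
      ((2 * n + 2) * (trinomialPair n).1 + (n + 1) * (trinomialPair n).2) / (n + 2))

lemma trinomialPair_eq (n : ℕ) : trinomialPair n = (trinomial n 0, trinomial n 1) := by
  induction n with
  | zero => simp [trinomialPair, trinomial]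
  | succ n ih =>
    rw [trinomialPair, ih]
    simp only
    rw [trinomial_succ_zero, ← trinomial_succ_one, Int.mul_ediv_cancel_left _ (by positivity)]

/-- The finitely many cases are evaluated with the linear recursion `trinomialPair`, avoiding the
threefold branching of `trinomial`. -/
lemma trinomial_ne_of_lt {n : ℕ} (h2 : 2 ≤ n) (hn : n < 17) :
    ((n : ℤ) ^ 2 + 3 * n + 6) * trinomial n 1 ≠ ((n : ℤ) ^ 2 + 3 * n - 6) * trinomial n 0 := by
  have h := trinomialPair_eq n
  rw [show trinomial n 0 = (trinomialPair n).1 by rw [h],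
    show trinomial n 1 = (trinomialPair n).2 by rw [h]]
  interval_cases n <;> simp [trinomialPair]

lemma trinomial_lt_of_le {n : ℕ} (hn : 16 ≤ n) :
    (((n : ℤ) + 1) ^ 2 + 3 * (n + 1) + 6) * trinomial (n + 1) 1 <
      (((n : ℤ) + 1) ^ 2 + 3 * (n + 1) - 6) * trinomial (n + 1) 0 := by
  obtain ⟨hA, -, -, hAB⟩ := trinomial_bounds n
  have e0 := trinomial_succ_zero n
  have e1 := trinomial_succ_one n
  have hn : (16 : ℤ) ≤ n := by exact_mod_cast hn
  generalize (n : ℤ) = N at *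
  -- After clearing denominators the difference of the two sides is `hp`'s polynomial times
  -- `trinomial n 0` plus `hq`'s times the slack in `hAB`. The former is positive at 16 but not at
  -- 15, hence the threshold.
  have hp : 0 < 2 * N ^ 3 - 26 * N ^ 2 - 64 * N - 24 := by
    nlinarith [mul_nonneg (sub_nonneg.2 hn) (sq_nonneg N),
      mul_nonneg (sub_nonneg.2 hn) (sub_nonneg.2 hn)]
  have hq : 0 ≤ N ^ 3 + 8 * N ^ 2 + N - 18 := by
    have : 0 ≤ N ^ 3 := by positivity
    nlinarith [sq_nonneg N]
  refine lt_of_mul_lt_mul_left ?_ (show 0 ≤ (N + 1) * (N + 2) by positivity)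
  have key := add_pos_of_pos_of_nonneg (mul_pos hp hA) (mul_nonneg hq (sub_nonneg.2 hAB))
  rw [e0, ← sub_pos]
  refine key.trans_eq ?_
  linear_combination (N + 1) * ((N + 1) ^ 2 + 3 * (N + 1) + 6) * e1

lemma mult_replicate_two_ne {n : ℕ} (hn : 2 ≤ n) :
    mult 4 (List.replicate n 2) ≠
      mult 2 (List.replicate n 2) + mult 0 (List.replicate n 2) := by
  intro h
  have h4 := charProd_replicate_two n 2
  have h2 := charProd_replicate_two n 1
  have h0 := charProd_replicate_two n 0
  have m4 := mult_eq_charProd (List.replicate n 2) 4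
  have m2 := mult_eq_charProd (List.replicate n 2) 2
  have m0 := mult_eq_charProd (List.replicate n 2) 0
  norm_num at h4 h2 h0 m4 m2 m0
  have e2 := trinomial_two n
  have e3 := trinomial_three n
  have hd : trinomial n 2 - trinomial n 3 =
      trinomial n 1 - trinomial n 2 + (trinomial n 0 - trinomial n 1) := by
    rw [← h4, ← h2, ← h0, ← m4, ← m2, ← m0]
    exact_mod_cast h
  -- The contiguous relations eliminate the coefficients at 2 and 3.
  have key : ((n : ℤ) ^ 2 + 3 * n + 6) * trinomial n 1 =
      ((n : ℤ) ^ 2 + 3 * n - 6) * trinomial n 0 := by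
    linear_combination (-((n : ℤ) + 2) * (n + 3)) * hd + (n + 2) * e3 * (-1)
      + (2 * (n : ℤ) + 8) * e2
  rcases lt_or_ge n 17 with h17 | h17
  · exact trinomial_ne_of_lt hn h17 key
  · obtain ⟨k, rfl⟩ : ∃ k, n = k + 1 := ⟨n - 1, by omega⟩
    have := trinomial_lt_of_le (n := k) (by omega)
    push_cast at key
    exact this.ne key

/-! ### Constant lists with entry at least 3: radial monotonicity -/

lemma sum_range_parity {M : Type*} [AddCommMonoid M] (f : ℕ → M) (a n : ℕ) :
    ∑ i ∈ range (a + 2 * n), (if a ≤ i ∧ i % 2 = a % 2 then f i else 0) =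
      ∑ r ∈ range n, f (a + 2 * r) := by
  induction n with
  | zero =>
    refine sum_eq_zero fun i hi => if_neg ?_
    have := mem_range.1 hi
    omega
  | succ n ih =>
    rw [show a + 2 * (n + 1) = a + 2 * n + 1 + 1 by ring, sum_range_succ, sum_range_succ, ih,
      sum_range_succ, if_pos (by omega), if_neg (by omega), add_zero]

/-- The multiplicity of `V_k` in `V_i ⊗ V_j`. -/
def triangle (i j k : ℕ) : ℚ :=
  if (i + j + k) % 2 = 0 ∧ i ≤ j + k ∧ j ≤ i + k ∧ k ≤ i + j then 1 else 0

lemma triangle_comm (i j k : ℕ) : triangle i j k = triangle j i k := by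
  unfold triangle
  congr 1
  rw [eq_iff_iff]
  omega

/-- The multiplicities of the ball `∑ (i + 1) V_i`, over `i ≤ R` of the same parity as `R`. -/
def ball (R i : ℕ) : ℚ := if i ≤ R ∧ i % 2 = R % 2 then i + 1 else 0

lemma ball_nonneg (R i : ℕ) : 0 ≤ ball R i := by
  unfold ball; split_ifs <;> positivity

/-- The obstruction to monotonicity of `k ↦ N k / (k + 1)` for `V_i ⊗ V_j`. -/
def defect (k i j : ℕ) : ℚ := (k + 3) * triangle i j k - (k + 1) * triangle i j (k + 2)

lemma defect_comm (k i j : ℕ) : defect k i j = defect k j i := by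
  simp only [defect, triangle_comm i j]

lemma sum_ball_triangle {R x k a n : ℕ} (hpar : (R + x + k) % 2 = 0) (ha : a = (k - x) + (x - k))
    (hn : a + 2 * n = min (k + x) R + 2) :
    ∑ i ∈ range (R + 1), ball R i * triangle i x k = n * (a + n) := by
  have h1 : ∑ r ∈ range n, ((a + 2 * r : ℕ) + 1 : ℚ) = n * (a + n) := by
    clear hn
    induction n with
    | zero => simp
    | succ n ih => rw [sum_range_succ, ih]; push_cast; ring
  rw [← h1, ← sum_range_parity (fun i => (i + 1 : ℚ))]
  have h2 : ∀ i, ball R i * triangle i x k =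
      if i < a + 2 * n then (if a ≤ i ∧ i % 2 = a % 2 then (i + 1 : ℚ) else 0) else 0 := by
    intro i
    unfold ball triangle
    by_cases hi : a ≤ i ∧ i % 2 = a % 2 ∧ i < a + 2 * n
    · rw [if_pos (by omega), if_pos (by omega), if_pos (by omega), if_pos (by omega), mul_one]
    · by_cases hb : i ≤ R ∧ i % 2 = R % 2
      · rw [if_neg (c := _ = 0 ∧ _) (by omega), mul_zero]
        split_ifs <;> first | rfl | omega
      · rw [if_neg hb, zero_mul]
        split_ifs <;> first | rfl | omega
  simp only [h2]
  rw [← sum_filter]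
  refine (sum_subset (fun i hi => ?_) fun i hi hi' => ?_)
  · exact mem_range.2 (mem_filter.1 hi).2
  · rw [if_neg]
    intro hc
    simp only [mem_filter, mem_range, not_and] at hi hi'
    omega

lemma sum_ball_triangle_eq_zero {R x k : ℕ}
    (h : (R + x + k) % 2 = 1 ∨ R < (k - x) + (x - k)) :
    ∑ i ∈ range (R + 1), ball R i * triangle i x k = 0 := by
  refine sum_eq_zero fun i hi => ?_
  unfold ball triangle
  by_cases hb : i ≤ R ∧ i % 2 = R % 2
  · rw [if_neg (c := _ = 0 ∧ _) (by omega), mul_zero]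
  · rw [if_neg hb, zero_mul]

/-- A ball tensored with `V_x` is radially decreasing as long as `x ≤ R + 1`. Its multiplicity at
`k`, when nonzero, is a sum of odd-step terms equal to `((H + 2)² - (k - x)²) / 4` with `H = min (k
+ x) R`, which leaves a polynomial inequality. -/
lemma sum_ball_defect_nonneg {R x : ℕ} (hx : x ≤ R + 1) (k : ℕ) :
    0 ≤ ∑ i ∈ range (R + 1), ball R i * defect k i x := by
  have e : ∑ i ∈ range (R + 1), ball R i * defect k i x =
      (k + 3) * ∑ i ∈ range (R + 1), ball R i * triangle i x k -
      (k + 1) * ∑ i ∈ range (R + 1), ball R i * triangle i x (k + 2) := by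
    rw [mul_sum, mul_sum, ← sum_sub_distrib]
    refine sum_congr rfl fun i _ => ?_
    rw [defect]; ring
  have hnn : ∀ k, 0 ≤ ∑ i ∈ range (R + 1), ball R i * triangle i x k := fun k =>
    sum_nonneg fun i _ => mul_nonneg (ball_nonneg _ _) (by unfold triangle; split_ifs <;> norm_num)
  rw [e]
  by_cases hz : (R + x + (k + 2)) % 2 = 1 ∨ R < (k + 2 - x) + (x - (k + 2))
  · rw [sum_ball_triangle_eq_zero hz, mul_zero, sub_zero]
    exact mul_nonneg (by positivity) (hnn k)
  · obtain ⟨n, hn⟩ : ∃ n, (k - x) + (x - k) + 2 * n = min (k + x) R + 2 :=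
      ⟨(min (k + x) R + 2 - ((k - x) + (x - k))) / 2, by omega⟩
    obtain ⟨n', hn'⟩ : ∃ n, (k + 2 - x) + (x - (k + 2)) + 2 * n = min (k + 2 + x) R + 2 :=
      ⟨(min (k + 2 + x) R + 2 - ((k + 2 - x) + (x - (k + 2)))) / 2, by omega⟩
    rw [sum_ball_triangle (by omega) rfl hn, sum_ball_triangle (by omega) rfl hn', sub_nonneg]
    have sq_sum : ∀ a b n H : ℕ, (a - b) + (b - a) + 2 * n = H + 2 →
        4 * ((n : ℚ) * (((a - b) + (b - a) : ℕ) + n)) = ((H : ℚ) + 2) ^ 2 - (a - b) ^ 2 := by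
      intro a b n H h
      have h' : (((a - b) + (b - a) : ℕ) : ℚ) + 2 * n = H + 2 := by exact_mod_cast h
      have habs : (((a - b) + (b - a) : ℕ) : ℚ) ^ 2 = ((a : ℚ) - b) ^ 2 := by
        rcases le_total a b with hab | hab
        · rw [Nat.sub_eq_zero_of_le hab, zero_add, Nat.cast_sub hab]; ring
        · rw [Nat.sub_eq_zero_of_le hab, add_zero, Nat.cast_sub hab]
      rw [← h', ← habs]; ring
    have s1 := sq_sum _ _ _ _ hn
    have s2 := sq_sum _ _ _ _ hn'
    have hk : (0 : ℚ) ≤ k := by positivity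
    have hx0 : (0 : ℚ) ≤ x := by positivity
    have hxR : (x : ℚ) ≤ R + 1 := by exact_mod_cast hx
    suffices h : ((k : ℚ) + 1) * ((((min (k + 2 + x) R : ℕ) : ℚ) + 2) ^ 2 - ((k + 2 : ℕ) - x) ^ 2) ≤
        (k + 3) * ((((min (k + x) R : ℕ) : ℚ) + 2) ^ 2 - (k - x) ^ 2) by
      rw [← s1, ← s2] at h
      linarith
    push Not at hz
    -- Neither, exactly one, or both of the minima are cut off by `R`, up to ties; in the first case
    -- equality holds.
    rcases (by omega : k + x + 2 ≤ R ∨ R = k + x ∨ R + 2 ≤ k + x) with hc | hc | hc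
    · rw [min_eq_left (by omega), min_eq_left (by omega)]
      push_cast
      exact le_of_eq (by ring)
    · rw [min_eq_right (by omega), min_eq_left (by omega), hc]
      push_cast
      nlinarith [mul_nonneg hk hx0]
    · rw [min_eq_right (by omega), min_eq_right (by omega)]
      push_cast
      rcases le_total x (k + 1) with hkx | hkx
      · have h1 : (k : ℚ) + 2 - x ≤ R := by
          have : k + 2 ≤ R + x := by omega
          have : (k : ℚ) + 2 ≤ R + x := by exact_mod_cast this
          linarith
        have h2 : (x : ℚ) ≤ k + 1 := by exact_mod_cast hkx
        have h3 : 0 ≤ ((k : ℚ) + 1) * (k - x + 1) := mul_nonneg (by positivity) (by linarith)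
        have h4 : ((k : ℚ) - x) ^ 2 ≤ (R + 2) ^ 2 :=
          sq_le_sq' (by linarith) (by linarith)
        nlinarith
      · have h1 : (x + 1 : ℚ) ^ 2 ≤ (R + 2) ^ 2 := pow_le_pow_left₀ (by positivity) (by linarith) 2
        nlinarith [mul_nonneg hk hk]

/-- Monotonicity of `k ↦ N k / (k + 1)` along each parity class. -/
def RadialDecreasing (N : ℕ → ℚ) : Prop := ∀ k, (k + 1) * N (k + 2) ≤ (k + 3) * N k

/-- A nonnegative radially decreasing function is a nonnegative combination of balls, so a linear
functional need only be tested on balls. The induction subtracts the multiple of the largest ball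
that kills the top value; nonnegativity is required only at the top of each parity class. -/
lemma sum_nonneg_of_ball (c : ℕ → ℚ)
    (hc : ∀ R, 0 ≤ ∑ i ∈ range (R + 1), ball R i * c i) (M : ℕ) : ∀ (N : ℕ → ℚ),
    (∀ i < M, M ≤ i + 2 → 0 ≤ N i) →
    (∀ i, i + 2 < M → (i + 1) * N (i + 2) ≤ (i + 3) * N i) →
    0 ≤ ∑ i ∈ range M, N i * c i := by
  induction M with
  | zero => intro N _ _; simp
  | succ M ih =>
    intro N htop hdec
    have hM := htop M (by omega) (by omega)
    have hpos : (0 : ℚ) < M + 1 := by positivity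
    set φ := N M / (M + 1) with hφ
    have hφ0 : 0 ≤ φ := div_nonneg hM hpos.le
    have hNM : N M = φ * (M + 1) := by rw [hφ]; field_simp
    have h1 := ih (fun i => N i - φ * ball M i) ?_ ?_
    · have e : ∑ i ∈ range (M + 1), N i * c i =
          ∑ i ∈ range M, (N i - φ * ball M i) * c i +
            φ * ∑ i ∈ range (M + 1), ball M i * c i := by
        rw [sum_range_succ, sum_range_succ, mul_add, mul_sum, ← add_assoc, ← sum_add_distrib,
          hNM]
        congr 1
        · exact sum_congr rfl fun i _ => by ring
        · simp [ball]; ring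
      rw [e]
      exact add_nonneg h1 (mul_nonneg hφ0 (hc M))
    · intro i hi hi2
      rcases (by omega : M = i + 1 ∨ M = i + 2) with h | h
      · have := htop i (by omega) (by omega)
        simp only [ball]
        rw [if_neg (by omega)]
        simpa using this
      · have := hdec i (by omega)
        subst h
        simp only [ball]
        rw [if_pos (by omega)]
        rw [hNM] at this
        push_cast at this
        have h3 : (0 : ℚ) < i + 3 := by positivity
        refine nonneg_of_mul_nonneg_right ?_ h3
        nlinarith
    · intro i hi
      have := hdec i (by omega)
      simp only [ball]
      by_cases hpar : i % 2 = M % 2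
      · rw [if_pos (by omega), if_pos (by omega)]
        push_cast
        nlinarith
      · rw [if_neg (by omega), if_neg (by omega)]
        simpa using this

/-- Tensor products preserve radial decrease, as convolution does for radially decreasing functions
on `ℝ³`. By bilinearity two balls suffice; the smaller is expanded into its `V_j`, all of which
satisfy `j ≤ R`. -/
lemma sum_defect_nonneg {N N' : ℕ → ℚ} (hN : RadialDecreasing N) (hN' : RadialDecreasing N')
    (h0 : ∀ i, 0 ≤ N i) (h0' : ∀ i, 0 ≤ N' i) (k M : ℕ) :
    0 ≤ ∑ i ∈ range M, N i * ∑ j ∈ range M, N' j * defect k i j := by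
  have key : ∀ R R', R' ≤ R → 0 ≤ ∑ j ∈ range (R' + 1), ball R' j *
      ∑ i ∈ range (R + 1), ball R i * defect k i j := by
    intro R R' h
    refine sum_nonneg fun j hj => mul_nonneg (ball_nonneg _ _) (sum_ball_defect_nonneg ?_ k)
    have := mem_range.1 hj
    omega
  have key' : ∀ R R', 0 ≤ ∑ j ∈ range (R' + 1), ball R' j *
      ∑ i ∈ range (R + 1), ball R i * defect k i j := by
    intro R R'
    rcases le_total R' R with h | h
    · exact key R R' h
    · refine (key R' R h).trans_eq ?_
      simp only [mul_sum]
      rw [sum_comm]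
      refine sum_congr rfl fun i _ => sum_congr rfl fun j _ => ?_
      rw [defect_comm]; ring
  refine sum_nonneg_of_ball _ (fun R => ?_) M N (fun i _ _ => h0 i) (fun i _ => hN i)
  have e : ∑ i ∈ range (R + 1), ball R i * ∑ j ∈ range M, N' j * defect k i j =
      ∑ j ∈ range M, N' j * ∑ i ∈ range (R + 1), ball R i * defect k i j := by
    simp only [mul_sum]
    rw [sum_comm]
    exact sum_congr rfl fun i _ => sum_congr rfl fun j _ => by ring
  rw [e]
  exact sum_nonneg_of_ball _ (fun R' => key' R R') M N' (fun i _ _ => h0' i) (fun i _ => hN' i)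

lemma mult_cons_eq_sum_triangle (x k : ℕ) (l : List ℕ) {M : ℕ} (hM : k + x < M) :
    (mult k (x :: l) : ℚ) = ∑ j ∈ range M, mult j l * triangle x j k := by
  rw [mult, Nat.cast_sum]
  simp only [triangle, mul_ite, mul_one, mul_zero]
  rw [← sum_filter]
  refine sum_bij' (fun q _ => k + x - 2 * q) (fun j _ => (k + x - j) / 2) ?_ ?_ ?_ ?_ ?_
  · intro q hq
    have := mem_range.1 hq
    simp only [mem_filter, mem_range]
    omega
  · intro j hj
    simp only [mem_filter, mem_range] at hj ⊢
    omega
  · intro q hq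
    have := mem_range.1 hq
    omega
  · intro j hj
    simp only [mem_filter, mem_range] at hj ⊢
    omega
  · intro q hq
    rfl

lemma charMul_charMul_self (t : ℕ) (F : ℤ → ℤ) (h : ℤ) :
    charMul t (charMul t F) h = ∑ i ∈ range (t + 1), charMul (2 * i) F h := by
  induction t with
  | zero => simp [charMul]
  | succ t ih =>
    rw [charMul_succ_succ, ih, sum_range_succ _ (t + 1), add_comm,
      show t + t + 2 = 2 * (t + 1) by ring]

lemma mult_cons_cons_self (t k : ℕ) (l : List ℕ) :
    mult k (t :: t :: l) = ∑ i ∈ range (t + 1), mult k (2 * i :: l) := by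
  have h : (mult k (t :: t :: l) : ℤ) = ∑ i ∈ range (t + 1), (mult k (2 * i :: l) : ℤ) := by
    simp only [mult_eq_charProd, charProd_cons, charMul_charMul_self]
  exact_mod_cast h

/-- The multiplicities of `V_t ⊗ V_t`. -/
def squareMult (t i : ℕ) : ℚ := if i % 2 = 0 ∧ i ≤ 2 * t then 1 else 0

lemma squareMult_nonneg (t i : ℕ) : 0 ≤ squareMult t i := by
  unfold squareMult; split_ifs <;> norm_num

lemma radialDecreasing_squareMult (t : ℕ) : RadialDecreasing (squareMult t) := by
  intro k
  by_cases h : (k + 2) % 2 = 0 ∧ k + 2 ≤ 2 * t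
  · rw [squareMult, squareMult, if_pos h, if_pos (by omega)]; linarith
  · rw [squareMult, if_neg h, mul_zero]
    exact mul_nonneg (by positivity) (squareMult_nonneg _ _)

lemma mult_cons_cons_self_eq_sum (t k : ℕ) (l : List ℕ) {M : ℕ} (hM : k + 2 * t < M) :
    (mult k (t :: t :: l) : ℚ) =
      ∑ i ∈ range M, squareMult t i * ∑ j ∈ range M, mult j l * triangle i j k := by
  rw [mult_cons_cons_self, Nat.cast_sum]
  have e : ∀ i ∈ range (t + 1), (mult k (2 * i :: l) : ℚ) =
      ∑ j ∈ range M, mult j l * triangle (0 + 2 * i) j k := by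
    intro i hi
    have := mem_range.1 hi
    rw [zero_add]
    exact mult_cons_eq_sum_triangle _ _ _ (by omega)
  rw [sum_congr rfl e, ← sum_range_parity (fun i => ∑ j ∈ range M, mult j l * triangle i j k)]
  simp only [squareMult, ite_mul, one_mul, zero_mul]
  rw [← sum_filter, ← sum_filter]
  refine sum_congr ?_ fun _ _ => rfl
  ext i
  simp only [mem_filter, mem_range]
  omega

lemma RadialDecreasing.cons_cons_self {l : List ℕ}
    (hl : RadialDecreasing fun k => (mult k l : ℚ)) (t : ℕ) :
    RadialDecreasing fun k => (mult k (t :: t :: l) : ℚ) := by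
  intro k
  have h := sum_defect_nonneg (radialDecreasing_squareMult t) hl (squareMult_nonneg t)
    (fun i => Nat.cast_nonneg _) k (k + 2 + 2 * t + 1)
  simp only
  rw [mult_cons_cons_self_eq_sum t k l (M := k + 2 + 2 * t + 1) (by omega),
    mult_cons_cons_self_eq_sum t (k + 2) l (M := k + 2 + 2 * t + 1) (by omega), ← sub_nonneg]
  refine h.trans_eq ?_
  rw [mul_sum, mul_sum, ← sum_sub_distrib]
  refine sum_congr rfl fun i _ => ?_
  rw [mul_left_comm, mul_left_comm _ (squareMult t i), ← mul_sub]
  congr 1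
  rw [mul_sum, mul_sum, ← sum_sub_distrib]
  refine sum_congr rfl fun j _ => ?_
  rw [defect]; ring

lemma radialDecreasing_nil : RadialDecreasing fun k => (mult k [] : ℚ) := by
  intro k
  simp only [mult]
  rw [if_neg (by omega)]
  simp only [Nat.cast_zero, mul_zero]
  positivity

lemma mult_singleton (t k : ℕ) : mult k [t] = if k = t then 1 else 0 := by
  simp only [mult]
  split_ifs with h
  · subst h
    rw [sum_eq_single k, if_pos (by omega)]
    · intro q hq hqk
      have := mem_range.1 hq
      exact if_neg (by omega)
    · intro hk
      exact absurd (mem_range.2 (by omega)) hk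
  · refine sum_eq_zero fun q hq => if_neg ?_
    have := mem_range.1 hq
    omega

lemma mult_pair_eq_triangle (x t k : ℕ) : (mult k [x, t] : ℚ) = triangle x t k := by
  rw [mult_cons_eq_sum_triangle x k [t] (M := k + x + t + 1) (by omega)]
  simp only [mult_singleton]
  rw [sum_eq_single t]
  · simp
  · intro j _ hj; simp [hj]
  · intro h
    exact absurd (mem_range.2 (by omega)) h

lemma mult_cube {t k : ℕ} : mult k [t, t, t] =
    if (k + t) % 2 = 0 then min (k + 1) ((3 * t + 2 - k) / 2) else 0 := by
  have h : ∀ i, mult k [2 * i, t] =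
      if (k + t) % 2 = 0 ∧ (t - k + (k - t)) / 2 ≤ i ∧ i ≤ (t + k) / 2 then 1 else 0 := by
    intro i
    have h := mult_pair_eq_triangle (2 * i) t k
    rw [triangle] at h
    by_cases hc : (k + t) % 2 = 0 ∧ (t - k + (k - t)) / 2 ≤ i ∧ i ≤ (t + k) / 2
    · rw [if_pos hc]
      rw [if_pos (by omega)] at h
      exact_mod_cast h
    · rw [if_neg hc]
      rw [if_neg (by omega)] at h
      exact_mod_cast h
  rw [mult_cons_cons_self, sum_congr rfl fun i _ => h i]
  by_cases hp : (k + t) % 2 = 0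
  · rw [if_pos hp, ← card_filter]
    have : ({i ∈ range (t + 1) | (k + t) % 2 = 0 ∧ (t - k + (k - t)) / 2 ≤ i ∧ i ≤ (t + k) / 2} :
        Finset ℕ) = Icc ((t - k + (k - t)) / 2) (min t ((t + k) / 2)) := by
      ext i
      simp only [mem_filter, mem_range, mem_Icc]
      omega
    rw [this, Nat.card_Icc]
    omega
  · simp [hp]

lemma radialDecreasing_cube (t : ℕ) : RadialDecreasing fun k => (mult k [t, t, t] : ℚ) := by
  intro k
  simp only [mult_cube]
  norm_cast
  by_cases h : (k + t) % 2 = 0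
  · rw [if_pos (by omega), if_pos h]
    rcases le_or_gt k t with hk | hk
    · rw [min_eq_left (a := k + 1) (by omega), mul_comm (k + 3)]
      exact Nat.mul_le_mul_left _ (min_le_left _ _)
    · exact Nat.mul_le_mul (by omega) (by omega)
  · rw [if_neg (by omega)]; simp

/-- The induction tensors with `V_t ⊗ V_t` because a single `V_t` with `t ≥ 2` is not radially
decreasing; hence the separate base case of the cube. -/
lemma radialDecreasing_replicate (t n : ℕ) (hn : 2 ≤ n) :
    RadialDecreasing fun k => (mult k (List.replicate n t) : ℚ) := by
  induction n using Nat.strong_induction_on with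
  | _ n ih =>
    rcases (by omega : n = 2 ∨ n = 3 ∨ 4 ≤ n) with rfl | rfl | h
    · exact radialDecreasing_nil.cons_cons_self t
    · exact radialDecreasing_cube t
    · obtain ⟨n, rfl⟩ : ∃ k, n = k + 2 := ⟨n - 2, by omega⟩
      exact (ih n (by omega) (by omega)).cons_cons_self t

lemma RadialDecreasing.le {N : ℕ → ℚ} (hN : RadialDecreasing N) (k r : ℕ) :
    (k + 1) * N (k + 2 * r) ≤ (k + 2 * r + 1) * N k := by
  induction r with
  | zero => simp
  | succ r ih =>
    have h := hN (k + 2 * r)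
    rw [show k + 2 * (r + 1) = k + 2 * r + 2 by ring]
    push_cast at h ⊢
    have h1 : (0 : ℚ) < k + 2 * r + 1 := by positivity
    refine le_of_mul_le_mul_left ?_ h1
    calc ((k : ℚ) + 2 * r + 1) * ((k + 1) * N (k + 2 * r + 2))
        = (k + 1) * ((k + 2 * r + 1) * N (k + 2 * r + 2)) := by ring
      _ ≤ (k + 1) * ((k + 2 * r + 3) * N (k + 2 * r)) :=
          mul_le_mul_of_nonneg_left h (by positivity)
      _ = (k + 2 * r + 3) * ((k + 1) * N (k + 2 * r)) := by ring
      _ ≤ (k + 2 * r + 3) * ((k + 2 * r + 1) * N k) :=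
          mul_le_mul_of_nonneg_left ih (by positivity)
      _ = _ := by ring

lemma RadialDecreasing.sum_gt {N : ℕ → ℚ} (hN : RadialDecreasing N) {t : ℕ} (ht : 3 ≤ t)
    (hpos : 0 < N (2 * t)) : N (2 * t) < ∑ i ∈ range t, N (2 * i) := by
  have h1 : ∀ i ∈ range t, ((2 * i : ℕ) + 1 : ℚ) * N (2 * t) ≤ (2 * t + 1) * N (2 * i) := by
    intro i hi
    have hi := mem_range.1 hi
    have h := hN.le (2 * i) (t - i)
    have e : 2 * i + 2 * (t - i) = 2 * t := by omega
    rw [e] at h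
    have e' : ((2 * i : ℕ) : ℚ) + 2 * ((t - i : ℕ) : ℚ) = 2 * t := by exact_mod_cast e
    rwa [e'] at h
  have h2 := sum_le_sum h1
  rw [← sum_mul, ← mul_sum] at h2
  have h3 : ∑ i ∈ range t, ((2 * i : ℕ) + 1 : ℚ) = t ^ 2 := by
    clear h1 h2 ht hpos
    induction t with
    | zero => simp
    | succ t ih => rw [sum_range_succ, ih]; push_cast; ring
  rw [h3] at h2
  have ht' : (3 : ℚ) ≤ t := by exact_mod_cast ht
  have h4 : (2 * t + 1 : ℚ) < t ^ 2 := by nlinarith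
  refine lt_of_mul_lt_mul_left ((mul_lt_mul_of_pos_right h4 hpos).trans_le h2) (by positivity)

/-! ### Assembly of the cases -/

lemma mult_replicate_ne {t n : ℕ} (ht : 0 < t) (hn : 2 ≤ n) (he : Even (n * t))
    (h1 : ¬ (t = 1 ∧ n = 2)) :
    mult 0 (List.replicate n t ++ [t + t]) ≠ mult 0 (List.replicate n t ++ [t - 1, t - 1]) := by
  rw [mult_append_singleton, mult_append_pair, min_self]
  rcases (by omega : t = 1 ∨ t = 2 ∨ 3 ≤ t) with rfl | rfl | h3
  · simpa using mult_replicate_one_ne (by omega) (by simpa using he)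
  · simpa [sum_range_succ] using mult_replicate_two_ne hn
  · have hpos : 0 < mult (2 * t) (List.replicate n t) := by
      obtain ⟨r, hr⟩ := he
      have hn2 : 2 * t ≤ n * t := Nat.mul_le_mul_right t hn
      refine mult_pos _ _ ⟨t + r, ?_⟩ ?_ ?_
      · simp; omega
      · simpa using hn2
      · intro x hx
        have := List.eq_of_mem_replicate hx
        simp; omega
    have h := (radialDecreasing_replicate t n hn).sum_gt h3 (by exact_mod_cast hpos)
    have h' : mult (2 * t) (List.replicate n t) <
        ∑ i ∈ range t, mult (2 * i) (List.replicate n t) := by exact_mod_cast h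
    rw [← two_mul]
    refine (h'.trans_eq ?_).ne
    rw [← sum_range_reflect, show t - 1 + 1 = t by omega]
    refine sum_congr rfl fun q hq => ?_
    congr 1
    have := mem_range.1 hq
    omega

lemma exists_pair {a : List ℕ} (ha : IsReduced a) (h4 : 4 ≤ a.length) (hne : a ≠ [1, 1, 1, 1]) :
    ∃ b x y, (b ++ [x, y]).Perm a ∧ mult 0 (b ++ [x + y]) ≠ mult 0 (b ++ [x - 1, y - 1]) := by
  by_cases hc : ∃ t, ∀ x ∈ a, x = t
  · obtain ⟨t, ht⟩ := hc
    have hrep := List.eq_replicate_of_mem ht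
    obtain ⟨n, hn⟩ : ∃ n, a.length = n + 2 := ⟨a.length - 2, by omega⟩
    rw [hn, List.replicate_add] at hrep
    refine ⟨List.replicate n t, t, t, by rw [hrep]; rfl, ?_⟩
    obtain ⟨s, hs, hp, -⟩ := ha.exists_of_perm (List.Perm.refl a)
    refine mult_replicate_ne (hp t ?_) (by omega) ?_ ?_
    · rw [hrep]; simp
    · rw [hrep] at hs
      simp at hs
      exact ⟨s - t, by omega⟩
    · rintro ⟨rfl, rfl⟩
      exact hne hrep
  · obtain ⟨c, x, y, z, hyz, hp⟩ := exists_perm_of_not_const h4 hc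
    obtain ⟨s, h1, h2, h3⟩ := ha.exists_of_perm hp
    obtain ⟨b, x', y', h5, h6⟩ := exists_pair_of_exchange hyz h1 h2 h3
    exact ⟨b, x', y', h5.trans hp, h6⟩

end SchubertLines


theorem lemmaL :
    (∀ a : List ℕ, SchubertLines.IsReduced a → 4 ≤ a.length → a ≠ [1, 1, 1, 1] →
      ∃ (b : List ℕ) (x y : ℕ), (b ++ [x, y]).Perm a ∧
        SchubertLines.K (b ++ [x + y]) ≠ SchubertLines.K (b ++ [x - 1, y - 1]) ∧
        SchubertLines.K (b ++ [x + y]) ≠ 0 ∧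
        SchubertLines.K (b ++ [x - 1, y - 1]) ≠ 0) ∧
    (SchubertLines.K [1, 1, 1 + 1] = 1 ∧ SchubertLines.K [1, 1, 1 - 1, 1 - 1] = 1) := by
  refine ⟨fun a ha h4 hne => ?_, ?_, ?_⟩
  · obtain ⟨b, x, y, hp, hxy⟩ := SchubertLines.exists_pair ha h4 hne
    obtain ⟨s, hs, hpos, hpair⟩ := ha.exists_of_perm hp
    have hb : b ≠ [] := by
      rintro rfl
      have := hp.length_eq
      simp at this
      omega
    obtain ⟨h1, h2⟩ := SchubertLines.mult_pos_of_reduced hb hs hpos hpair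
    have hx := hpos x (by simp)
    have hy := hpos y (by simp)
    simp only [List.sum_append, List.sum_cons, List.sum_nil] at hs
    have e1 : SchubertLines.K (b ++ [x + y]) = SchubertLines.mult 0 (b ++ [x + y]) :=
      SchubertLines.K_eq_mult ⟨s, by simp only [List.sum_append, List.sum_cons, List.sum_nil]; omega⟩
    have e2 : SchubertLines.K (b ++ [x - 1, y - 1]) = SchubertLines.mult 0 (b ++ [x - 1, y - 1]) :=
      SchubertLines.K_eq_mult
        ⟨s - 1, by simp only [List.sum_append, List.sum_cons, List.sum_nil]; omega⟩
    exact ⟨b, x, y, hp, by rwa [e1, e2], by rw [e1]; exact h1.ne', by rw [e2]; exact h2.ne'⟩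
  · rw [SchubertLines.K_eq_mult ⟨2, rfl⟩]
    rfl
  · rw [SchubertLines.K_eq_mult ⟨1, rfl⟩]
    rfl
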